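/- Let $V$ be a Euclidean space of finite dimension $\dim V\ge 1$, let $\Gamma\subset V$ be a dense finitely generated subgroup (so $\Gamma$ is free abelian of finite rank), and let $\mathcal W$ be a finite set of affine hyperplanes of $V$ whose normals span $V$. Assume that $\mathcal W$ is indecomposable: it cannot be written as a union $\mathcal W=\mathcal W_1\cup\mathcal W_2$ of two nonempty subsets such that the spans $V_1,V_2$ of the normals of the members of $\mathcal W_1$ and of $\mathcal W_2$, respectively, are complementary subspaces of $V$. A singular space is a nonempty affine subspace of the form $\Theta=\bigcap_{(W,x)\in A}(W+x)$ with $A$ a finite subset of $\mathcal W\times\Gamma$ (for $A=\emptyset$ this is $V$ itself); its stabilizer is $\Gamma^{\Theta}=\{x\in\Gamma : \Theta+x=\Theta\}$. The group $\Gamma$ acts by translation on the set of zero-dimensional singular spaces; let $L_0$ be the number of orbits of this action. If $L_0$ is finite, then $\nu:=\frac{\operatorname{rank}\Gamma}{\dim V}$ is a natural number, and every singular space $\Theta$ satisfies $$\operatorname{rank}\Gamma^{\Theta}=\nu\,\dim\Theta .$$ In particular, the rank of the stabilizer of a singular space depends only on the dimension of that space. -/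

import Mathlib

open scoped Pointwise

noncomputable section

namespace ProjectionPattern

variable {V : Type*} [NormedAddCommGroup V] [InnerProductSpace ℝ V]

/-- An affine hyperplane: a nonempty affine subspace whose normal vectors form a line. -/
def IsHyperplane (W : AffineSubspace ℝ V) : Prop :=
  (W : Set V).Nonempty ∧ Module.finrank ℝ W.directionᗮ = 1

/-- The linear span of all normal vectors of the members of a family of affine hyperplanes. -/
def normalSpan (S : Set (AffineSubspace ℝ V)) : Submodule ℝ V :=
  Submodule.span ℝ {v | ∃ W ∈ S, v ∈ W.directionᗮ}

/-- The normals of the family cannot be split: the family is not the union of two nonempty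
subfamilies whose normals span complementary subspaces. -/
def Indecomposable (𝓦 : Set (AffineSubspace ℝ V)) : Prop :=
  ∀ S₁ S₂ : Set (AffineSubspace ℝ V), S₁.Nonempty → S₂.Nonempty → 𝓦 = S₁ ∪ S₂ →
    ¬ IsCompl (normalSpan S₁) (normalSpan S₂)

/-- The data `(V, Γ, 𝓦)`: a dense subgroup `Γ` of `V` which is finitely generated (hence free
abelian of finite rank), and a finite set `𝓦` of affine hyperplanes of `V` whose normals span `V`
and are indecomposable. -/
structure IsData (Γ : AddSubgroup V) (𝓦 : Set (AffineSubspace ℝ V)) : Prop where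
  fg : Γ.FG
  dense : Dense (Γ : Set V)
  finite : 𝓦.Finite
  hyperplane : ∀ W ∈ 𝓦, IsHyperplane W
  span_normals : normalSpan 𝓦 = ⊤
  indecomposable : Indecomposable 𝓦

/-- A singular space: a nonempty intersection of the translates `W + x`, where `(W, x)` runs
through a finite subset of `𝓦 × Γ`. -/
def IsSingularSpace (Γ : AddSubgroup V) (𝓦 : Set (AffineSubspace ℝ V))
    (Θ : AffineSubspace ℝ V) : Prop :=
  (Θ : Set V).Nonempty ∧
    ∃ A : Finset (AffineSubspace ℝ V × V), (∀ p ∈ A, p.1 ∈ 𝓦 ∧ p.2 ∈ Γ) ∧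
      Θ = ⨅ p ∈ A, p.2 +ᵥ p.1

/-- The set of singular spaces of dimension `l`. -/
def singularSpaces (Γ : AddSubgroup V) (𝓦 : Set (AffineSubspace ℝ V)) (l : ℕ) :
    Set (AffineSubspace ℝ V) :=
  {Θ | IsSingularSpace Γ 𝓦 Θ ∧ Module.finrank ℝ Θ.direction = l}

/-- Two singular `l`-spaces are equivalent if one is a translate of the other by an element
of `Γ`. -/
def translationSetoid (Γ : AddSubgroup V) (𝓦 : Set (AffineSubspace ℝ V)) (l : ℕ) :
    Setoid (singularSpaces Γ 𝓦 l) where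
  r Θ Ψ := ∃ x ∈ Γ, x +ᵥ (Θ : AffineSubspace ℝ V) = Ψ
  iseqv :=
    { refl := fun Θ => ⟨0, Γ.zero_mem, zero_vadd _ _⟩
      symm := by
        rintro Θ Ψ ⟨x, hx, h⟩
        exact ⟨-x, Γ.neg_mem hx, by rw [← h, neg_vadd_vadd]⟩
      trans := by
        rintro Θ Ψ Φ ⟨x, hx, h⟩ ⟨y, hy, h'⟩
        exact ⟨y + x, Γ.add_mem hy hx, by rw [add_vadd, h, h']⟩ }

/-- The set `I_l` of `Γ`-orbits of singular `l`-spaces. -/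
def OrbitSpace (Γ : AddSubgroup V) (𝓦 : Set (AffineSubspace ℝ V)) (l : ℕ) : Type _ :=
  Quotient (translationSetoid Γ 𝓦 l)

/-- The number `L_l` of `Γ`-orbits of singular `l`-spaces, possibly infinite. -/
def orbitCount (Γ : AddSubgroup V) (𝓦 : Set (AffineSubspace ℝ V)) (l : ℕ) : ℕ∞ :=
  ENat.card (OrbitSpace Γ 𝓦 l)

/-- The stabilizer `{x ∈ Γ | Θ + x = Θ}` of an affine subspace `Θ`. -/
def stabilizer (Γ : AddSubgroup V) (Θ : AffineSubspace ℝ V) : AddSubgroup V where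
  carrier := {x | x ∈ Γ ∧ x +ᵥ Θ = Θ}
  zero_mem' := ⟨Γ.zero_mem, zero_vadd _ _⟩
  add_mem' := by
    rintro x y ⟨hx, h⟩ ⟨hy, h'⟩
    exact ⟨Γ.add_mem hx hy, by rw [add_vadd, h', h]⟩
  neg_mem' := by
    rintro x ⟨hx, h⟩
    exact ⟨Γ.neg_mem hx, by rw [neg_vadd_eq_iff, h]⟩

end ProjectionPattern

end

noncomputable section

namespace ProjectionPattern

variable {V : Type*} [NormedAddCommGroup V] [InnerProductSpace ℝ V]

/-! Choose hyperplanes in `𝓦` whose normals `b i` form a basis of `V`. Pairing with them embeds `Γ`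
in the product of the groups `⟪b i, Γ⟫`, and finiteness of `L₀` makes the cokernel torsion
(`isTorsionCokernel`). Hence ranks add up: `rank Γ` is the sum of all `pairingRank Γ (b i)`, and the
subgroup killed by some of the `b i` has as rank the sum over the others
(`finrank_eq_sum_pairingRank`). Comparing two bases that differ in one normal shows that the
exchanged normals have equal rank, and indecomposability spreads this to all of `𝓦`
(`pairingRank_eq`). The common value is `ν`; a stabilizer is the subgroup killed by the normals that
cut out `Θ`, which leaves `dim Θ` summands. -/

/-! ### Ranks of value groups -/

/-- The `ℤ`-linear form `x ↦ ⟪v, x⟫` on a subgroup of a Euclidean space. -/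
def pairing (Γ : AddSubgroup V) (v : V) : Γ →ₗ[ℤ] ℝ :=
  ((innerₗ V v).toAddMonoidHom.comp Γ.subtype).toIntLinearMap

@[simp]
lemma pairing_apply (Γ : AddSubgroup V) (v : V) (x : Γ) : pairing Γ v x = inner ℝ v (x : V) := rfl

/-- The rank of the group of values `⟪v, x⟫`, `x ∈ Γ`. -/
def pairingRank (Γ : AddSubgroup V) (v : V) : ℕ :=
  Module.finrank ℤ (LinearMap.range (pairing Γ v))

/-- Every tuple in the product of the groups `⟪b i, Γ⟫` has a nonzero multiple that is attained
simultaneously by a single element of `Γ`. -/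
def IsTorsionCokernel {ι : Type*} (Γ : AddSubgroup V) (b : ι → V) : Prop :=
  ∀ y : ι → Γ, ∃ m : ℤ, m ≠ 0 ∧ ∃ x : Γ, ∀ i, inner ℝ (b i) (x : V) = m * inner ℝ (b i) (y i : V)

lemma eq_of_forall_inner_eq {ι : Type*} {b : ι → V} (hb : Submodule.span ℝ (Set.range b) = ⊤)
    {x y : V} (h : ∀ i, inner ℝ (b i) x = inner ℝ (b i) y) : x = y := by
  rw [← sub_eq_zero]
  have hx : x - y ∈ (Submodule.span ℝ (Set.range b))ᗮ := by
    rw [Submodule.mem_orthogonal]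
    intro u hu
    induction hu using Submodule.span_induction with
    | mem u hu => obtain ⟨i, rfl⟩ := hu; rw [inner_sub_right, h, sub_self]
    | zero => simp
    | add u w _ _ hu hw => rw [inner_add_left, hu, hw, add_zero]
    | smul a u _ hu => rw [inner_smul_left, hu, mul_zero]
  simpa [hb] using hx

lemma finrank_eq_sum_pairingRank {ι : Type*} [Fintype ι] [DecidableEq ι] {Γ : AddSubgroup V}
    (hΓ : Γ.FG) {b : ι → V} (hb : Submodule.span ℝ (Set.range b) = ⊤)
    (htors : IsTorsionCokernel Γ b) (s : Finset ι) (K : AddSubgroup V)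
    (hK : ∀ x, x ∈ K ↔ x ∈ Γ ∧ ∀ i ∈ s, inner ℝ (b i) x = 0) :
    Module.finrank ℤ K = ∑ i ∈ sᶜ, pairingRank Γ (b i) := by
  have hKΓ : K ≤ Γ := fun x hx => ((hK x).1 hx).1
  have : Module.Finite ℤ Γ := Module.Finite.iff_addGroup_fg.2 ((AddGroup.fg_iff_addSubgroup_fg Γ).2 hΓ)
  let P := (i : {i // i ∈ sᶜ}) → LinearMap.range (pairing Γ (b i))
  let G : K →ₗ[ℤ] P := LinearMap.pi fun i =>
    (pairing Γ (b i)).rangeRestrict ∘ₗ (AddSubgroup.inclusion hKΓ).toIntLinearMap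
  have hG : ∀ x i, (G x i : ℝ) = inner ℝ (b i) (x : V) := fun x i => rfl
  have hinj : Function.Injective G := by
    intro x y hxy
    refine Subtype.ext (eq_of_forall_inner_eq hb fun i => ?_)
    by_cases hi : i ∈ s
    · rw [((hK x).1 x.2).2 i hi, ((hK y).1 y.2).2 i hi]
    · rw [← hG x ⟨i, Finset.mem_compl.2 hi⟩, hxy, hG]
  have hq : Module.finrank ℤ (P ⧸ LinearMap.range G) = 0 := by
    rw [Module.finrank_eq_zero_iff_isTorsion]
    intro q
    obtain ⟨p, rfl⟩ := Submodule.Quotient.mk_surjective _ q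
    choose y hy using fun i => (p i).2
    -- The default `0` on `s` forces `x` to be orthogonal to those `b i`, so that `x` lies in `K`.
    obtain ⟨m, hm, x, hx⟩ := htors fun i => if h : i ∈ sᶜ then y ⟨i, h⟩ else 0
    have hxK : (x : V) ∈ K := (hK x).2 ⟨x.2, fun i hi => by
      rw [hx i, dif_neg (by simpa using hi)]; simp⟩
    refine ⟨⟨m, mem_nonZeroDivisors_of_ne_zero hm⟩, ?_⟩
    change m • (Submodule.Quotient.mk p : P ⧸ LinearMap.range G) = 0
    rw [← Submodule.Quotient.mk_smul, Submodule.Quotient.mk_eq_zero]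
    refine ⟨⟨x, hxK⟩, ?_⟩
    ext i
    rw [hG]
    change inner ℝ (b i) (x : V) = ((m • p i : LinearMap.range (pairing Γ (b i))) : ℝ)
    rw [hx i, dif_pos i.2]
    simp [← hy]
  have h1 := Submodule.finrank_quotient_add_finrank (LinearMap.range G)
  rw [hq, zero_add, LinearMap.finrank_range_of_inj hinj] at h1
  rw [h1, Module.finrank_pi_fintype]
  exact Finset.sum_coe_sort sᶜ fun i => pairingRank Γ (b i)

/-! ### Equations of hyperplanes and singular spaces -/

lemma exists_forall_inner_eq [FiniteDimensional ℝ V] {ι : Type*} [Fintype ι] {b : ι → V}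
    (hb : LinearIndependent ℝ b) (c : ι → ℝ) : ∃ p : V, ∀ i, inner ℝ (b i) p = c i := by
  obtain ⟨f, hf⟩ : ∃ f : V →ₗ[ℝ] ℝ, ∀ i, f (b i) = c i := by
    obtain ⟨f, hf⟩ := ((Module.Basis.span hb).constr ℝ c).exists_extend
    refine ⟨f, fun i => ?_⟩
    have := LinearMap.congr_fun hf (Module.Basis.span hb i)
    rw [Module.Basis.constr_basis] at this
    rwa [LinearMap.comp_apply, Submodule.subtype_apply, Module.Basis.span_apply] at this
  refine ⟨(InnerProductSpace.toDual ℝ V).symm f.toContinuousLinearMap, fun i => ?_⟩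
  rw [real_inner_comm, InnerProductSpace.toDual_symm_apply]
  exact hf i

/-- The hyperplane `W` is given by the equation `⟪v, p⟫ = c`. -/
structure IsEquation (W : AffineSubspace ℝ V) (v : V) (c : ℝ) : Prop where
  mem_iff : ∀ p, p ∈ W ↔ inner ℝ v p = c
  orthogonal_eq : W.directionᗮ = Submodule.span ℝ {v}

lemma IsHyperplane.exists_isEquation [FiniteDimensional ℝ V] {W : AffineSubspace ℝ V}
    (hW : IsHyperplane W) : ∃ v c, IsEquation W v c := by
  obtain ⟨⟨p, hp⟩, h⟩ := hW
  obtain ⟨⟨v, hvW⟩, -, hspan⟩ := finrank_eq_one_iff'.1 h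
  have hv : W.directionᗮ = Submodule.span ℝ {v} := by
    refine le_antisymm (fun w hw => ?_) (Submodule.span_le.2 (Set.singleton_subset_iff.2 hvW))
    obtain ⟨a, ha⟩ := hspan ⟨w, hw⟩
    exact Submodule.mem_span_singleton.2 ⟨a, congrArg Subtype.val ha⟩
  refine ⟨v, inner ℝ v p, fun q => ?_, hv⟩
  have := AffineSubspace.vadd_mem_iff_mem_direction (q -ᵥ p) (s := W) hp
  rw [vsub_vadd] at this
  rw [this, ← Submodule.orthogonal_orthogonal W.direction, hv,
    Submodule.mem_orthogonal_singleton_iff_inner_right, vsub_eq_sub, inner_sub_right, sub_eq_zero]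

lemma IsEquation.mem_vadd_iff {W : AffineSubspace ℝ V} {v : V} {c : ℝ} (h : IsEquation W v c)
    (y p : V) : p ∈ y +ᵥ W ↔ inner ℝ v p = c + inner ℝ v y := by
  have := AffineSubspace.vadd_mem_pointwise_vadd_iff (v := y) (s := W) (p := p - y)
  rw [vadd_eq_add, add_sub_cancel] at this
  rw [this, h.mem_iff, inner_sub_right, sub_eq_iff_eq_add]

section Equations

variable {𝓦 : Set (AffineSubspace ℝ V)} {n : AffineSubspace ℝ V → V} {c : AffineSubspace ℝ V → ℝ}

lemma normalSpan_eq_span_image (h : ∀ W ∈ 𝓦, IsEquation W (n W) (c W))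
    {S : Set (AffineSubspace ℝ V)} (hS : S ⊆ 𝓦) : normalSpan S = Submodule.span ℝ (n '' S) := by
  refine le_antisymm (Submodule.span_le.2 ?_) (Submodule.span_mono ?_)
  · rintro v ⟨W, hW, hv⟩
    rw [(h W (hS hW)).orthogonal_eq] at hv
    exact Submodule.span_mono (Set.singleton_subset_iff.2 (Set.mem_image_of_mem n hW)) hv
  · rintro _ ⟨W, hW, rfl⟩
    refine ⟨W, hW, ?_⟩
    rw [(h W (hS hW)).orthogonal_eq]
    exact Submodule.mem_span_singleton_self _

lemma mem_iInf_vadd_iff (h : ∀ W ∈ 𝓦, IsEquation W (n W) (c W))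
    {A : Finset (AffineSubspace ℝ V × V)} (hA : ∀ p ∈ A, p.1 ∈ 𝓦) (q : V) :
    q ∈ (⨅ p ∈ A, p.2 +ᵥ p.1) ↔
      ∀ p ∈ A, inner ℝ (n p.1) q = c p.1 + inner ℝ (n p.1) p.2 := by
  simp only [AffineSubspace.mem_iInf_iff]
  exact forall₂_congr fun p hp => (h p.1 (hA p hp)).mem_vadd_iff _ _

/-- Pigeonhole: for each `k`, the hyperplanes `b i` translated by `k • y i` meet in one point. Two
of these infinitely many indices give points in the same `Γ`-orbit, and the element of `Γ` joining
them is the required `x`. -/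
lemma isTorsionCokernel [FiniteDimensional ℝ V] {Γ : AddSubgroup V}
    (hL₀ : orbitCount Γ 𝓦 0 < ⊤) (h : ∀ W ∈ 𝓦, IsEquation W (n W) (c W))
    {ι : Type*} [Fintype ι] {b : ι → AffineSubspace ℝ V} (hb𝓦 : ∀ i, b i ∈ 𝓦)
    (hb : LinearIndependent ℝ (n ∘ b)) (hspan : Submodule.span ℝ (Set.range (n ∘ b)) = ⊤) :
    IsTorsionCokernel Γ (n ∘ b) := by
  classical
  intro y
  let A : ℕ → Finset (AffineSubspace ℝ V × V) := fun k =>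
    Finset.univ.image fun i => (b i, ((k : ℤ) • y i : Γ))
  let Θ : ℕ → AffineSubspace ℝ V := fun k => ⨅ p ∈ A k, p.2 +ᵥ p.1
  have hA : ∀ k, ∀ p ∈ A k, p.1 ∈ 𝓦 ∧ p.2 ∈ Γ := by
    intro k p hp
    obtain ⟨i, -, rfl⟩ := Finset.mem_image.1 hp
    exact ⟨hb𝓦 i, ((k : ℤ) • y i : Γ).2⟩
  have hΘ : ∀ k q, q ∈ Θ k ↔
      ∀ i, inner ℝ (n (b i)) q = c (b i) + k * inner ℝ (n (b i)) (y i : V) := by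
    intro k q
    rw [mem_iInf_vadd_iff h fun p hp => (hA k p hp).1]
    simp [A, ← Nat.cast_smul_eq_nsmul ℝ, inner_smul_right]
  choose p hp using fun k : ℕ =>
    exists_forall_inner_eq hb fun i => c (b i) + k * inner ℝ (n (b i)) (y i : V)
  have hpΘ : ∀ k, p k ∈ Θ k := fun k => (hΘ k _).2 (hp k)
  have hdim : ∀ k, Module.finrank ℝ (Θ k).direction = 0 := by
    intro k
    have : (Θ k : Set V).Subsingleton := fun q hq q' hq' =>
      eq_of_forall_inner_eq hspan fun i => ((hΘ k q).1 hq i).trans ((hΘ k q').1 hq' i).symm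
    rw [AffineSubspace.direction_eq_vectorSpan, vectorSpan_of_subsingleton _ this, finrank_bot]
  let Φ : ℕ → singularSpaces Γ 𝓦 0 := fun k => ⟨Θ k, ⟨⟨p k, hpΘ k⟩, A k, hA k, rfl⟩, hdim k⟩
  have : Finite (Quotient (translationSetoid Γ 𝓦 0)) := ENat.card_lt_top.1 hL₀
  obtain ⟨k, l, hkl, heq⟩ := Finite.exists_ne_map_eq_of_infinite fun k =>
    Quotient.mk (translationSetoid Γ 𝓦 0) (Φ k)
  obtain ⟨x, hx, hxΘ⟩ : ∃ x ∈ Γ, x +ᵥ Θ k = Θ l := Quotient.exact heq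
  -- The constants `c (b i)` cancel between the two points, leaving the factor `l - k`.
  refine ⟨l - k, sub_ne_zero.2 (by exact_mod_cast hkl.symm), ⟨x, hx⟩, fun i => ?_⟩
  have hmem : x +ᵥ p k ∈ Θ l := hxΘ ▸ AffineSubspace.vadd_mem_pointwise_vadd_iff.2 (hpΘ k)
  have := (hΘ l _).1 hmem i
  rw [vadd_eq_add, inner_add_right] at this
  have hk := hp k i
  simp only [Function.comp_apply] at hk ⊢
  push_cast
  linarith

lemma mem_stabilizer_iff (h : ∀ W ∈ 𝓦, IsEquation W (n W) (c W)) (Γ : AddSubgroup V)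
    {A : Finset (AffineSubspace ℝ V × V)} (hA : ∀ p ∈ A, p.1 ∈ 𝓦)
    {q : V} (hq : q ∈ (⨅ p ∈ A, p.2 +ᵥ p.1 : AffineSubspace ℝ V)) (x : V) :
    x ∈ stabilizer Γ (⨅ p ∈ A, p.2 +ᵥ p.1) ↔ x ∈ Γ ∧ ∀ p ∈ A, inner ℝ (n p.1) x = 0 := by
  refine and_congr_right fun _ => ⟨fun hx p hp => ?_, fun hx => ?_⟩
  · have h1 := AffineSubspace.vadd_mem_pointwise_vadd_iff (v := x) |>.2 hq
    rw [hx] at h1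
    have h2 := (mem_iInf_vadd_iff h hA _).1 h1 p hp
    rwa [vadd_eq_add, inner_add_right, (mem_iInf_vadd_iff h hA _).1 hq p hp, add_eq_right] at h2
  · ext q'
    have h1 := AffineSubspace.vadd_mem_pointwise_vadd_iff (v := x) (p := q' - x)
      (s := ⨅ p ∈ A, p.2 +ᵥ p.1)
    rw [vadd_eq_add, add_sub_cancel] at h1
    rw [h1, mem_iInf_vadd_iff h hA, mem_iInf_vadd_iff h hA]
    refine forall₂_congr fun p hp => ?_
    rw [inner_sub_right, hx p hp, sub_zero]

lemma direction_iInf_vadd (h : ∀ W ∈ 𝓦, IsEquation W (n W) (c W))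
    {A : Finset (AffineSubspace ℝ V × V)} (hA : ∀ p ∈ A, p.1 ∈ 𝓦)
    {q : V} (hq : q ∈ (⨅ p ∈ A, p.2 +ᵥ p.1 : AffineSubspace ℝ V)) :
    (⨅ p ∈ A, p.2 +ᵥ p.1 : AffineSubspace ℝ V).direction =
      (Submodule.span ℝ (n '' (Prod.fst '' (A : Set (AffineSubspace ℝ V × V)))))ᗮ := by
  ext x
  rw [← AffineSubspace.vadd_mem_iff_mem_direction x hq, mem_iInf_vadd_iff h hA,
    Submodule.mem_orthogonal]
  have hx : ∀ p ∈ A, (inner ℝ (n p.1) (x +ᵥ q) = c p.1 + inner ℝ (n p.1) p.2 ↔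
      inner ℝ (n p.1) x = 0) := fun p hp => by
    rw [vadd_eq_add, inner_add_right, (mem_iInf_vadd_iff h hA _).1 hq p hp, add_eq_right]
  rw [forall₂_congr hx]
  refine ⟨fun H u hu => ?_, fun H p hp =>
    H _ (Submodule.subset_span ⟨_, ⟨p, hp, rfl⟩, rfl⟩)⟩
  induction hu using Submodule.span_induction with
  | mem u hu => obtain ⟨_, ⟨p, hp, rfl⟩, rfl⟩ := hu; exact H p hp
  | zero => simp
  | add u w _ _ hu hw => rw [inner_add_left, hu, hw, add_zero]
  | smul a u _ hu => rw [inner_smul_left, hu, mul_zero]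

end Equations

/-! ### Basis exchange and constancy of the rank -/

lemma span_range_update_eq_top {ι : Type*} [DecidableEq ι] (b : Module.Basis ι ℝ V) {w : V}
    {i : ι} (hi : b.repr w i ≠ 0) :
    Submodule.span ℝ (Set.range (Function.update b i w)) = ⊤ := by
  set S := Submodule.span ℝ (Set.range (Function.update b i w))
  have hne : ∀ j, j ≠ i → b j ∈ S := fun j hj =>
    Submodule.subset_span ⟨j, Function.update_of_ne hj _ _⟩
  have hw : w ∈ S := Submodule.subset_span ⟨i, Function.update_self _ _ _⟩
  have hmem : b.repr w i • b i ∈ S := by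
    have hsum : b.repr w i • b i + (b.repr w).support.sum
        (fun j => if j = i then 0 else b.repr w j • b j) = w := by
      conv_rhs => rw [← b.linearCombination_repr w, Finsupp.linearCombination_apply, Finsupp.sum,
        ← Finset.add_sum_erase _ _ (Finsupp.mem_support_iff.2 hi)]
      rw [← Finset.add_sum_erase (a := i) (b.repr w).support _ (Finsupp.mem_support_iff.2 hi),
        if_pos rfl, zero_add]
      congr 1
      exact Finset.sum_congr rfl fun j hj => if_neg (Finset.ne_of_mem_erase hj)
    rw [← eq_sub_iff_add_eq] at hsum
    rw [hsum]
    refine S.sub_mem hw (S.sum_mem fun j _ => ?_)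
    split_ifs with hj
    · exact S.zero_mem
    · exact S.smul_mem _ (hne j hj)
  rw [eq_top_iff, ← b.span_eq, Submodule.span_le]
  rintro _ ⟨j, rfl⟩
  by_cases hj : j = i
  · subst hj
    exact (S.smul_mem_iff hi).1 hmem
  · exact hne j hj

section Equations

variable [FiniteDimensional ℝ V] {Γ : AddSubgroup V} {𝓦 : Set (AffineSubspace ℝ V)}
  {n : AffineSubspace ℝ V → V} {c : AffineSubspace ℝ V → ℝ}

lemma finrank_eq_sum {ι : Type*} [Fintype ι] (hΓ : Γ.FG)
    (hL₀ : orbitCount Γ 𝓦 0 < ⊤) (h : ∀ W ∈ 𝓦, IsEquation W (n W) (c W))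
    {b : ι → AffineSubspace ℝ V} (hb𝓦 : ∀ i, b i ∈ 𝓦)
    (hb : LinearIndependent ℝ (n ∘ b)) (hspan : Submodule.span ℝ (Set.range (n ∘ b)) = ⊤) :
    Module.finrank ℤ Γ = ∑ i, pairingRank Γ (n (b i)) := by
  classical
  simpa using finrank_eq_sum_pairingRank hΓ hspan (isTorsionCokernel hL₀ h hb𝓦 hb hspan) ∅ Γ
    (by simp)

/-- Putting `n W` in place of `n (b i)` gives another basis of normals. Both bases compute `rank Γ`,
and all other summands agree. -/
lemma pairingRank_eq_of_repr_ne_zero {ι : Type*} [Fintype ι] (hΓ : Γ.FG)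
    (hL₀ : orbitCount Γ 𝓦 0 < ⊤) (h : ∀ W ∈ 𝓦, IsEquation W (n W) (c W))
    {b : ι → AffineSubspace ℝ V} (hb𝓦 : ∀ i, b i ∈ 𝓦) (B : Module.Basis ι ℝ V)
    (hB : ⇑B = n ∘ b) {W : AffineSubspace ℝ V} (hW : W ∈ 𝓦) {i : ι}
    (hi : B.repr (n W) i ≠ 0) :
    pairingRank Γ (n W) = pairingRank Γ (n (b i)) := by
  classical
  have hcomp : n ∘ Function.update b i W = Function.update B i (n W) := by
    rw [hB, Function.comp_update]
  have hspan : Submodule.span ℝ (Set.range (n ∘ Function.update b i W)) = ⊤ := by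
    rw [hcomp, span_range_update_eq_top B hi]
  have h1 := finrank_eq_sum hΓ hL₀ h hb𝓦 (hB ▸ B.linearIndependent) (hB ▸ B.span_eq)
  have hmem : ∀ j, Function.update b i W j ∈ 𝓦 := by
    intro j
    by_cases hj : j = i
    · subst hj; simpa using hW
    · simpa [hj] using hb𝓦 j
  have h2 := finrank_eq_sum hΓ hL₀ h hmem (linearIndependent_of_top_le_span_of_card_eq_finrank
    hspan.ge (Module.finrank_eq_card_basis B).symm) hspan
  rw [h1, ← Finset.add_sum_erase _ _ (Finset.mem_univ i),
    ← Finset.add_sum_erase _ (fun j => pairingRank Γ (n (Function.update b i W j)))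
      (Finset.mem_univ i), Function.update_self] at h2
  have h3 : ∀ j ∈ Finset.univ.erase i,
      pairingRank Γ (n (Function.update b i W j)) = pairingRank Γ (n (b j)) := fun j hj => by
    rw [Function.update_of_ne (Finset.ne_of_mem_erase hj)]
  rw [Finset.sum_congr rfl h3] at h2
  exact (Nat.add_right_cancel h2).symm

/-- By exchange, a normal involves only basis vectors of its own rank. If two ranks occurred, the
hyperplanes of rank `r W` and the remaining ones would have normals spanning complementary
subspaces. -/
lemma pairingRank_eq (hΓ : Γ.FG) (hL₀ : orbitCount Γ 𝓦 0 < ⊤)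
    (h : ∀ W ∈ 𝓦, IsEquation W (n W) (c W)) (htop : normalSpan 𝓦 = ⊤)
    (hind : Indecomposable 𝓦) {ι : Type*} [Fintype ι] {b : ι → AffineSubspace ℝ V}
    (hb𝓦 : ∀ i, b i ∈ 𝓦) (B : Module.Basis ι ℝ V) (hB : ⇑B = n ∘ b)
    {W W' : AffineSubspace ℝ V} (hW : W ∈ 𝓦) (hW' : W' ∈ 𝓦) :
    pairingRank Γ (n W') = pairingRank Γ (n W) := by
  by_contra hne
  set r := fun W => pairingRank Γ (n W)
  let S : Set ℕ → Set (AffineSubspace ℝ V) := fun R => {X ∈ 𝓦 | r X ∈ R}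
  have hunion : 𝓦 = S {r W} ∪ S {r W}ᶜ := by
    ext X
    simp [S, ← and_or_left, em]
  have hle : ∀ R, normalSpan (S R) ≤ Submodule.span ℝ (B '' {i | r (b i) ∈ R}) := by
    intro R
    rw [normalSpan_eq_span_image h fun X hX => hX.1, Submodule.span_le]
    rintro _ ⟨X, ⟨hX, hXR⟩, rfl⟩
    refine B.mem_span_image.2 fun i hi => ?_
    have := pairingRank_eq_of_repr_ne_zero hΓ hL₀ h hb𝓦 B hB hX (Finsupp.mem_support_iff.1 hi)
    exact (show r (b i) ∈ R from (show r X = r (b i) from this) ▸ hXR)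
  refine hind (S {r W}) (S {r W}ᶜ) ⟨W, hW, rfl⟩ ⟨W', hW', hne⟩ hunion ⟨?_, ?_⟩
  · refine (B.linearIndependent.disjoint_span_image ?_).mono (hle _) (hle _)
    exact Set.disjoint_left.2 fun i hi hi' => hi' hi
  · rw [codisjoint_iff, ← htop, normalSpan_eq_span_image h fun X hX => hX.1,
      normalSpan_eq_span_image h fun X hX => hX.1, normalSpan_eq_span_image h subset_rfl,
      ← Submodule.span_union, ← Set.image_union, ← hunion]

end Equations

end ProjectionPattern

end

/-! ### The main theorem -/

open ProjectionPattern in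
theorem theorem5p2 {V : Type*} [NormedAddCommGroup V] [InnerProductSpace ℝ V]
    [FiniteDimensional ℝ V] [Nontrivial V]
    (Γ : AddSubgroup V) (𝓦 : Set (AffineSubspace ℝ V))
    (hdata : ProjectionPattern.IsData Γ 𝓦)
    (hL₀ : ProjectionPattern.orbitCount Γ 𝓦 0 < ⊤) :
    ∃ ν : ℕ, (ν : ℚ) = (Module.finrank ℤ Γ : ℚ) / (Module.finrank ℝ V : ℚ) ∧
      ∀ Θ : AffineSubspace ℝ V, ProjectionPattern.IsSingularSpace Γ 𝓦 Θ →
        Module.finrank ℤ (ProjectionPattern.stabilizer Γ Θ) =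
          ν * Module.finrank ℝ Θ.direction := by
  classical
  have hex : ∀ W : AffineSubspace ℝ V, ∃ v c, W ∈ 𝓦 → IsEquation W v c := fun W => by
    by_cases hW : W ∈ 𝓦
    · obtain ⟨v, c, h⟩ := (hdata.hyperplane W hW).exists_isEquation
      exact ⟨v, c, fun _ => h⟩
    · exact ⟨0, 0, fun h => absurd h hW⟩
  choose n c h using hex
  have hspan𝓦 : Submodule.span ℝ (n '' 𝓦) = ⊤ := by
    rw [← normalSpan_eq_span_image h subset_rfl, hdata.span_normals]
  obtain ⟨W, hW⟩ : 𝓦.Nonempty := by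
    by_contra! hempty
    simp [hempty] at hspan𝓦
  refine ⟨pairingRank Γ (n W), ?_⟩
  have hsub : ∀ (A : Finset (AffineSubspace ℝ V × V)) (Θ : AffineSubspace ℝ V),
      (∀ p ∈ A, p.1 ∈ 𝓦) → Θ = ⨅ p ∈ A, p.2 +ᵥ p.1 → (Θ : Set V).Nonempty →
      Module.finrank ℤ (ProjectionPattern.stabilizer Γ Θ) =
        pairingRank Γ (n W) * Module.finrank ℝ Θ.direction := by
    rintro A _ hA rfl ⟨q, hq⟩
    set T : Set (AffineSubspace ℝ V) := Prod.fst '' (A : Set (AffineSubspace ℝ V × V))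
    have hT : T ⊆ 𝓦 := by rintro _ ⟨p, hp, rfl⟩; exact hA p hp
    have h0 : LinearIndepOn ℝ n (∅ : Set (AffineSubspace ℝ V)) := linearIndepOn_empty ℝ n
    -- A basis of normals adapted to `Θ`: `T₀` is a maximal independent part of the hyperplanes
    -- cutting out `Θ`, and `E` completes it within `𝓦`.
    set T₀ := h0.extend (Set.empty_subset T)
    have hT₀ : LinearIndepOn ℝ n T₀ := h0.linearIndepOn_extend _
    have hT₀T : T₀ ⊆ T := h0.extend_subset _
    have hspanT : Submodule.span ℝ (n '' T₀) = Submodule.span ℝ (n '' T) :=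
      h0.span_image_extend_eq_span_image _
    set E := hT₀.extend (hT₀T.trans hT)
    have hE : LinearIndepOn ℝ n E := hT₀.linearIndepOn_extend _
    have hE𝓦 : E ⊆ 𝓦 := hT₀.extend_subset _
    have hT₀E : T₀ ⊆ E := hT₀.subset_extend _
    let b : E → AffineSubspace ℝ V := Subtype.val
    have hspan : Submodule.span ℝ (Set.range (n ∘ b)) = ⊤ := by
      rw [Set.range_comp, Subtype.range_coe, hT₀.span_image_extend_eq_span_image, hspan𝓦]
    have : Fintype E := (hdata.finite.subset hE𝓦).fintype
    have hb𝓦 : ∀ i, b i ∈ 𝓦 := fun i => hE𝓦 i.2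
    let B := Module.Basis.mk hE hspan.ge
    have hB : ⇑B = n ∘ b := Module.Basis.coe_mk _ _
    let s : Finset E := Finset.univ.filter fun i => (i : AffineSubspace ℝ V) ∈ T₀
    have hrank := finrank_eq_sum_pairingRank hdata.fg hspan
      (isTorsionCokernel hL₀ h hb𝓦 hE hspan) s
      (ProjectionPattern.stabilizer Γ (⨅ p ∈ A, p.2 +ᵥ p.1)) fun x => by
        rw [mem_stabilizer_iff h Γ hA hq]
        refine and_congr_right fun _ => ⟨fun H i hi => ?_, fun H p hp => ?_⟩
        · obtain ⟨p, hp, hpi⟩ := hT₀T (Finset.mem_filter.1 hi).2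
          simpa [← hpi, b] using H p hp
        · have hmem : n p.1 ∈ Submodule.span ℝ (n '' T₀) :=
            hspanT ▸ Submodule.subset_span ⟨_, ⟨p, hp, rfl⟩, rfl⟩
          have hle : Submodule.span ℝ (n '' T₀) ≤ (ℝ ∙ x)ᗮ := by
            rw [Submodule.span_le]
            rintro _ ⟨X, hX, rfl⟩
            exact Submodule.mem_orthogonal_singleton_iff_inner_left.2
              (H ⟨X, hT₀E hX⟩ (Finset.mem_filter.2 ⟨Finset.mem_univ _, hX⟩))
          exact Submodule.mem_orthogonal_singleton_iff_inner_left.1 (hle hmem)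
    have hconst : ∀ i, pairingRank Γ ((n ∘ b) i) = pairingRank Γ (n W) := fun i =>
      pairingRank_eq hdata.fg hL₀ h hdata.span_normals hdata.indecomposable hb𝓦 B hB hW (hb𝓦 i)
    have hcard : s.card = Module.finrank ℝ (Submodule.span ℝ (n '' T)) := by
      have : Fintype T₀ := (hdata.finite.subset (hT₀T.trans hT)).fintype
      rw [← hspanT, Set.image_eq_range, finrank_span_eq_card hT₀,
        ← Fintype.card_coe s]
      exact Fintype.card_congr
        { toFun := fun i => ⟨i, (Finset.mem_filter.1 i.2).2⟩
          invFun := fun i => ⟨⟨i, hT₀E i.2⟩, Finset.mem_filter.2 ⟨Finset.mem_univ _, i.2⟩⟩ }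
    have hdim := (Submodule.span ℝ (n '' T)).finrank_add_finrank_orthogonal
    have hcompl := s.card_add_card_compl
    rw [hrank, Finset.sum_congr rfl fun i _ => hconst i, Finset.sum_const, smul_eq_mul, mul_comm,
      direction_iInf_vadd h hA hq]
    congr 1
    change sᶜ.card = Module.finrank ℝ (Submodule.span ℝ (n '' T))ᗮ
    rw [Module.finrank_eq_card_basis B] at hdim
    omega
  refine ⟨?_, fun Θ ⟨hne, A, hA, hΘ⟩ => hsub A Θ (fun p hp => (hA p hp).1) hΘ hne⟩
  -- `V` is the empty intersection and its stabilizer is `Γ`, which identifies `ν`.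
  have hΓ := hsub ∅ ⊤ (by simp) (by simp) ⟨0, trivial⟩
  have hstab : stabilizer Γ (⊤ : AffineSubspace ℝ V) = Γ :=
    le_antisymm (fun x hx => hx.1) fun x hx => ⟨hx, AffineSubspace.pointwise_vadd_top x⟩
  rw [hstab, AffineSubspace.direction_top, finrank_top] at hΓ
  rw [hΓ, Nat.cast_mul, mul_div_cancel_right₀]
  exact_mod_cast Module.finrank_pos.ne'
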